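/- Let $h$ be a (closed, filled) regular hexagon in the Euclidean plane with centre $X$ and side length $\frac43$. Among all closed unit disks $d$ (disks of radius $1$) containing $X$, the minimum of the area of $h\cap d$ exists and equals $$\Delta=\frac{\sqrt3}{36}+\frac{\sqrt{11}}{12}+\frac{\pi}{2}-\frac12\arctan\left(\frac{5\sqrt3-\sqrt{11}}{5+\sqrt{11}\,\sqrt3}\right),$$ and $\Delta\approx1.6645$, i.e. $|\Delta-1.6645|<0.00005$. Moreover, the minimum is attained by every such disk $d$ for which $X$ lies on the boundary of $d$ and the centre of $d$ is collinear with $X$ and a vertex of $h$. -/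

import Mathlib

/-- The Euclidean plane. -/
abbrev Plane : Type := EuclideanSpace ℝ (Fin 2)

/-- The vertex number `k` (counterclockwise) of the regular hexagon with centre `X` and side
length `s`, whose vertex number `0` is seen from `X` in the direction of angle `φ`. (In a regular
hexagon the distance from the centre to a vertex is the side length; see the two lemmas below.) -/
noncomputable def hexVertex (X : Plane) (s φ : ℝ) (k : Fin 6) : Plane :=
  X + s • !₂[Real.cos (φ + (k : ℕ) * (Real.pi / 3)), Real.sin (φ + (k : ℕ) * (Real.pi / 3))]

/-- The (closed, filled) regular hexagon with centre `X`, side length `s` and orientation `φ`. -/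
noncomputable def regularHexagon (X : Plane) (s φ : ℝ) : Set Plane :=
  convexHull ℝ (Set.range (hexVertex X s φ))

/-- The area of a plane set. -/
noncomputable def area (A : Set Plane) : ℝ := (MeasureTheory.volume : MeasureTheory.Measure Plane).real A

/-- The (closed) unit disk with centre `Y`. -/
def unitDisk (Y : Plane) : Set Plane := Metric.closedBall Y 1

/-- The constant `Δ`. -/
noncomputable def minDiskHexArea : ℝ :=
  √3 / 36 + √11 / 12 + Real.pi / 2
    - 1 / 2 * Real.arctan ((5 * √3 - √11) / (5 + √11 * √3))

theorem dist_hexVertex_center (X : Plane) {s : ℝ} (hs : 0 ≤ s) (φ : ℝ) (k : Fin 6) :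
    dist (hexVertex X s φ k) X = s := by
  rw [EuclideanSpace.dist_eq, Real.sqrt_eq_iff_mul_self_eq (by positivity) hs]
  simp only [hexVertex, Real.dist_eq, sq_abs, Fin.sum_univ_two, PiLp.add_apply, PiLp.smul_apply,
    smul_eq_mul, Matrix.cons_val_zero, Matrix.cons_val_one]
  have := Real.sin_sq_add_cos_sq (φ + (k : ℕ) * (Real.pi / 3))
  linear_combination s ^ 2 * this

theorem dist_hexVertex_succ (X : Plane) {s : ℝ} (hs : 0 ≤ s) (φ : ℝ) (k : Fin 6) :
    dist (hexVertex X s φ k) (hexVertex X s φ (k + 1)) = s := by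
  have key : ∀ a b : ℝ, Real.cos (a - b) = 1 / 2 →
      (s * Real.cos a - s * Real.cos b) ^ 2 + (s * Real.sin a - s * Real.sin b) ^ 2 = s * s := by
    intro a b h
    rw [Real.cos_sub] at h
    linear_combination s ^ 2 * Real.sin_sq_add_cos_sq a + s ^ 2 * Real.sin_sq_add_cos_sq b
      - 2 * s ^ 2 * h
  rw [EuclideanSpace.dist_eq, Real.sqrt_eq_iff_mul_self_eq (by positivity) hs]
  simp only [hexVertex, Real.dist_eq, sq_abs, Fin.sum_univ_two, PiLp.add_apply, PiLp.smul_apply,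
    smul_eq_mul, Matrix.cons_val_zero, Matrix.cons_val_one, add_sub_add_left_eq_sub]
  refine key _ _ ?_
  by_cases hk : k = 5
  · subst hk
    have : φ + ((5 : Fin 6) : ℕ) * (Real.pi / 3) - (φ + ((5 + 1 : Fin 6) : ℕ) * (Real.pi / 3))
        = 2 * Real.pi - Real.pi / 3 := by
      norm_num; ring
    rw [this, Real.cos_two_pi_sub, Real.cos_pi_div_three]
  · have h1 : ((k + 1 : Fin 6) : ℕ) = (k : ℕ) + 1 := by
      revert hk; revert k; decide
    have : φ + (k : ℕ) * (Real.pi / 3) - (φ + ((k + 1 : Fin 6) : ℕ) * (Real.pi / 3))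
        = - (Real.pi / 3) := by
      rw [h1]; push_cast; ring
    rw [this, Real.cos_neg, Real.cos_pi_div_three]

/-!
Everything is expressed in polar coordinates about the centre `X` of the hexagon, where the area of
a star-shaped set is half the integral of the square of its radial function.

*Reduction to disks with `X` on the boundary.* The hexagon `h` contains the unit disk `D` about
`X`, because its inradius `2 / √3` exceeds `1`. Let `u` be a unit vector and `0 ≤ t ≤ 1`. If `p`
lies in `h` and in `D + u`, then `p - u ∈ D ⊆ h`, so by convexity `p - (1 - t) u ∈ h`. Hence the
translation by `-(1 - t) u` maps `h ∩ (D + u)` into `h ∩ (D + t u)`, and moving the disk outwards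
can only decrease the area (`area_inter_unitDisk_add_le`).

*Disks with `X` on the boundary.* Measure angles `α` from the direction of the centre of the disk,
and let `θ` be the angle between this direction and a vertex. The squared radial functions are
`4 cos² α` for the disk (`diskRadialSq`) and `S (α + θ)` for the hexagon (`hexRadialSq`), where `S`
has period `π / 3` and takes values in `[4 / 3, 16 / 9]`. For `|α| ≤ π / 6` the hexagon is inside
the disk, and for `|α| ≥ π / 3` the disk is inside the hexagon. In the two remaining sectors
consider the circle about `X` through the points where the boundaries of disk and hexagon meet
when `θ = 0`; let `l` be its squared radius. The part of the hexagon outside the disk is covered by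
the part of the hexagon outside the circle and the part of the circle's interior outside the disk;
for `θ = 0` this cover is exact, since there `S` increases and `4 cos²` decreases with `|α|`
(`cutRadialSq_sub_le`). So, up to a term that does not depend on `θ`, the area is at least half the
integral of `S (α + θ)` over `|α| ≤ π / 6`, plus half the integral of `min (S (α + θ)) l` over
`π / 6 ≤ |α| ≤ π / 3`, with equality at `θ = 0`. Modulo `π / 3` each of these domains is a full
period, so both integrals are independent of `θ`, and `θ = 0` is optimal (`boundaryArea_zero_le`).

The value at `θ = 0` is an elementary integral (`boundaryArea_zero`). The meeting point is at the
angle `crossAngle = arccos (√3 / 6) / 2 + π / 12`.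
-/

/-! ### Areas in polar coordinates -/

/-- The unit vector of the plane in the direction of angle `α`. -/
noncomputable def unitVec (α : ℝ) : Plane := !₂[Real.cos α, Real.sin α]

theorem exists_eq_add_smul_unitVec (X p : Plane) :
    ∃ α : ℝ, p = X + dist p X • unitVec α := by
  set z : ℂ := Complex.orthonormalBasisOneI.repr.symm (p - X) with hz
  have hnorm : ‖z‖ = dist p X := by
    rw [hz, LinearIsometryEquiv.norm_map, dist_eq_norm]
  refine ⟨z.arg, ?_⟩
  have hre : z.re = p 0 - X 0 := by simp [hz]
  have him : z.im = p 1 - X 1 := by simp [hz]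
  have h0 := Complex.norm_mul_cos_arg z
  have h1 := Complex.norm_mul_sin_arg z
  rw [hnorm] at h0 h1
  ext i
  fin_cases i
  · simp [unitVec, h0, hre]
  · simp [unitVec, h1, him]

theorem lintegral_radial {a : ℝ} (ha : 0 ≤ a) :
    ∫⁻ r in Set.Ioi (0 : ℝ), ENNReal.ofReal r * Set.indicator {r : ℝ | r ^ 2 ≤ a} 1 r
      = ENNReal.ofReal (a / 2) := by
  have h1 : ∀ r : ℝ, ENNReal.ofReal r * Set.indicator {r : ℝ | r ^ 2 ≤ a} 1 r
      = Set.indicator {r : ℝ | r ^ 2 ≤ a} (fun r => ENNReal.ofReal r) r := by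
    intro r
    by_cases h : r ^ 2 ≤ a <;> simp [h]
  simp_rw [h1]
  have hm : MeasurableSet {r : ℝ | r ^ 2 ≤ a} :=
    measurableSet_le (by fun_prop) measurable_const
  rw [MeasureTheory.setLIntegral_indicator hm]
  have hs : {r : ℝ | r ^ 2 ≤ a} ∩ Set.Ioi 0 = Set.Ioc 0 √a := by
    ext r
    simp only [Set.mem_inter_iff, Set.mem_ofPred_eq, Set.mem_Ioi, Set.mem_Ioc]
    constructor
    · rintro ⟨h, h'⟩
      exact ⟨h', Real.le_sqrt_of_sq_le h⟩
    · rintro ⟨h, h'⟩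
      exact ⟨(Real.le_sqrt h.le ha).1 h', h⟩
  rw [hs, ← MeasureTheory.ofReal_integral_eq_lintegral_ofReal,
    ← intervalIntegral.integral_of_le (Real.sqrt_nonneg a), integral_id, Real.sq_sqrt ha]
  · norm_num
  · exact (intervalIntegrable_iff_integrableOn_Ioc_of_le (Real.sqrt_nonneg a)).1
      (continuous_id.intervalIntegrable _ _)
  · filter_upwards [MeasureTheory.ae_restrict_mem measurableSet_Ioc] with r hr using hr.1.le

/-- Area of a star-shaped set in polar coordinates, the set being given by the square `ρ` of its
radial function. -/
theorem area_eq_integral_radial {X : Plane} {K : Set Plane} (hK : MeasurableSet K) {ρ : ℝ → ℝ}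
    (hρ : Continuous ρ) (hρ0 : ∀ α, 0 ≤ ρ α)
    (h : ∀ r α : ℝ, 0 < r → (X + r • unitVec α ∈ K ↔ r ^ 2 ≤ ρ α)) :
    area K = 1 / 2 * ∫ α in (-Real.pi)..Real.pi, ρ α := by
  have hmp : MeasureTheory.MeasurePreserving
      (fun z : ℂ => X + Complex.orthonormalBasisOneI.repr z) :=
    (MeasureTheory.measurePreserving_add_left MeasureTheory.volume X).comp
      Complex.orthonormalBasisOneI.measurePreserving_repr
  have hpol : ∀ p : ℝ × ℝ, Complex.orthonormalBasisOneI.repr (Complex.polarCoord.symm p)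
      = p.1 • unitVec p.2 := by
    intro p
    ext i
    fin_cases i <;> simp [unitVec, Complex.cos_ofReal_re, Complex.sin_ofReal_re]
  have hvol : MeasureTheory.volume K = ∫⁻ α in Set.Ioo (-Real.pi) Real.pi,
      ENNReal.ofReal (ρ α / 2) := by
    rw [← hmp.measure_preimage hK.nullMeasurableSet,
      ← MeasureTheory.lintegral_indicator_one (hmp.measurable hK),
      ← Complex.lintegral_comp_polarCoord_symm]
    have hcongr : ∫⁻ p in polarCoord.target, ENNReal.ofReal p.1 •
          ((fun z : ℂ => X + Complex.orthonormalBasisOneI.repr z) ⁻¹' K).indicator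
            (1 : ℂ → ENNReal) (Complex.polarCoord.symm p)
        = ∫⁻ p in Set.Ioi (0 : ℝ) ×ˢ Set.Ioo (-Real.pi) Real.pi,
            ENNReal.ofReal p.1 * Set.indicator {q : ℝ × ℝ | q.1 ^ 2 ≤ ρ q.2} 1 p := by
      rw [polarCoord_target]
      refine MeasureTheory.setLIntegral_congr_fun
        (measurableSet_Ioi.prod measurableSet_Ioo) ?_
      intro p hp
      have hiff : Complex.polarCoord.symm p ∈
          (fun z : ℂ => X + Complex.orthonormalBasisOneI.repr z) ⁻¹' K ↔ p.1 ^ 2 ≤ ρ p.2 := by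
        rw [Set.mem_preimage, hpol]
        exact h p.1 p.2 hp.1
      by_cases hmem : p.1 ^ 2 ≤ ρ p.2
      · simp only [Set.indicator_of_mem (hiff.2 hmem), smul_eq_mul]
        simp [Set.indicator, hmem]
      · simp only [Set.indicator_of_notMem (fun hc => hmem (hiff.1 hc)), smul_eq_mul]
        simp [Set.indicator, hmem]
    have hmeas : Measurable (fun p : ℝ × ℝ => ENNReal.ofReal p.1 *
        Set.indicator {q : ℝ × ℝ | q.1 ^ 2 ≤ ρ q.2} (1 : ℝ × ℝ → ENNReal) p) := by
      refine (ENNReal.measurable_ofReal.comp measurable_fst).mul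
        (measurable_one.indicator (measurableSet_le (by fun_prop) ?_))
      exact hρ.measurable.comp measurable_snd
    rw [hcongr, MeasureTheory.Measure.volume_eq_prod, ← MeasureTheory.Measure.prod_restrict,
      MeasureTheory.lintegral_prod_symm' _ hmeas]
    refine MeasureTheory.lintegral_congr fun α => ?_
    exact lintegral_radial (hρ0 α)
  rw [area, MeasureTheory.measureReal_def, hvol,
    ← MeasureTheory.integral_eq_lintegral_of_nonneg_ae
      (Filter.Eventually.of_forall fun α => div_nonneg (hρ0 α) (by norm_num))
      (by fun_prop : Continuous fun α => ρ α / 2).aestronglyMeasurable,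
    ← MeasureTheory.integral_Ioc_eq_integral_Ioo,
    ← intervalIntegral.integral_of_le (by linarith [Real.pi_pos]),
    intervalIntegral.integral_div]
  ring

/-! ### The hexagon in polar coordinates -/

/-- The largest squared cosine of the angle between the direction of angle `x` and a normal of a
side of the regular hexagon that has a vertex in the direction of angle `0`. The reciprocal of the
squared radial function of the hexagon is proportional to it; opposite sides give the same square,
so three normals suffice. -/
noncomputable def maxCosSq (x : ℝ) : ℝ :=
  max (max (Real.cos (x - Real.pi / 6) ^ 2) (Real.cos (x + Real.pi / 6) ^ 2)) (Real.sin x ^ 2)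

theorem continuous_maxCosSq : Continuous maxCosSq := by
  unfold maxCosSq
  fun_prop

theorem periodic_maxCosSq : Function.Periodic maxCosSq (Real.pi / 3) := by
  intro x
  have h1 : Real.cos (x + Real.pi / 3 - Real.pi / 6) = Real.cos (x + Real.pi / 6) := by
    congr 1; ring
  have h2 : Real.cos (x + Real.pi / 3 + Real.pi / 6) = -Real.sin x := by
    rw [← Real.cos_add_pi_div_two]; congr 1; ring
  have h3 : Real.sin (x + Real.pi / 3) = Real.cos (x - Real.pi / 6) := by
    rw [← Real.cos_pi_div_two_sub, ← Real.cos_neg]; congr 1; ring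
  unfold maxCosSq
  rw [h1, h2, h3, neg_sq, max_comm, max_assoc]

theorem maxCosSq_neg (x : ℝ) : maxCosSq (-x) = maxCosSq x := by
  have h1 : Real.cos (-x - Real.pi / 6) = Real.cos (x + Real.pi / 6) := by
    rw [← Real.cos_neg]; congr 1; ring
  have h2 : Real.cos (-x + Real.pi / 6) = Real.cos (x - Real.pi / 6) := by
    rw [← Real.cos_neg]; congr 1; ring
  unfold maxCosSq
  rw [h1, h2, Real.sin_neg, neg_sq, max_comm (Real.cos (x + Real.pi / 6) ^ 2)]

theorem cos_sub_pi_div_six_ge {x : ℝ} (h0 : 0 ≤ x) (h1 : x ≤ Real.pi / 3) :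
    √3 / 2 ≤ Real.cos (x - Real.pi / 6) := by
  rw [← Real.cos_pi_div_six, ← Real.cos_abs (x - Real.pi / 6)]
  have hpi := Real.pi_pos
  have : |x - Real.pi / 6| ≤ Real.pi / 6 := abs_le.2 ⟨by linarith, by linarith⟩
  exact Real.cos_le_cos_of_nonneg_of_le_pi (abs_nonneg _) (by linarith) this

theorem maxCosSq_eq {x : ℝ} (h0 : 0 ≤ x) (h1 : x ≤ Real.pi / 3) :
    maxCosSq x = Real.cos (x - Real.pi / 6) ^ 2 := by
  have hpi := Real.pi_pos
  have hge := cos_sub_pi_div_six_ge h0 h1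
  have h3 : (0 : ℝ) ≤ √3 := Real.sqrt_nonneg 3
  have hsin : 0 ≤ Real.sin x := Real.sin_nonneg_of_nonneg_of_le_pi h0 (by linarith)
  have hcos : 0 ≤ Real.cos x :=
    Real.cos_nonneg_of_neg_pi_div_two_le_of_le (by linarith) (by linarith)
  unfold maxCosSq
  rw [max_eq_left, max_eq_left]
  · rw [Real.cos_add, Real.cos_sub, Real.cos_pi_div_six, Real.sin_pi_div_six]
    nlinarith [mul_nonneg (mul_nonneg hsin hcos) h3]
  · refine le_max_of_le_left ?_
    -- `sin x ≤ √3 / 2` on `[0, π / 3]`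
    have hle : Real.sin x ≤ √3 / 2 := by
      rw [← Real.sin_pi_div_three]
      exact Real.sin_le_sin_of_le_of_le_pi_div_two (by linarith) (by linarith) h1
    exact pow_le_pow_left₀ hsin (hle.trans hge) 2

theorem exists_int_mul_pi_div_three_add (x : ℝ) :
    ∃ (k : ℤ) (y : ℝ), 0 ≤ y ∧ y ≤ Real.pi / 3 ∧ x = y + k * (Real.pi / 3) := by
  have hpi : 0 < Real.pi / 3 := by positivity
  refine ⟨⌊x / (Real.pi / 3)⌋, x - ⌊x / (Real.pi / 3)⌋ * (Real.pi / 3), ?_, ?_, by ring⟩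
  · have := (le_div_iff₀ hpi).1 (Int.floor_le (x / (Real.pi / 3)))
    linarith
  · have := (div_lt_iff₀ hpi).1 (Int.lt_floor_add_one (x / (Real.pi / 3)))
    linarith

theorem maxCosSq_ge (x : ℝ) : 3 / 4 ≤ maxCosSq x := by
  obtain ⟨k, y, h0, h1, rfl⟩ := exists_int_mul_pi_div_three_add x
  rw [periodic_maxCosSq.int_mul k y, maxCosSq_eq h0 h1]
  have hs3 : √3 ^ 2 = 3 := Real.sq_sqrt (by norm_num)
  nlinarith [cos_sub_pi_div_six_ge h0 h1, Real.sqrt_nonneg 3]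

theorem maxCosSq_le_one (x : ℝ) : maxCosSq x ≤ 1 :=
  max_le (max_le (Real.cos_sq_le_one _) (Real.cos_sq_le_one _)) (Real.sin_sq_le_one _)

/-- The vertices of the hexagon may be numbered by arbitrary integers. -/
theorem exists_hexVertex_eq (X : Plane) (s φ : ℝ) (k : ℤ) :
    ∃ j : Fin 6, hexVertex X s φ j = X + s • unitVec (φ + k * (Real.pi / 3)) := by
  have h0 : 0 ≤ k % 6 := Int.emod_nonneg _ (by norm_num)
  have h6 : k % 6 < 6 := Int.emod_lt_of_pos _ (by norm_num)
  refine ⟨⟨(k % 6).toNat, by omega⟩, ?_⟩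
  have hcast : (((k % 6).toNat : ℕ) : ℝ) = ((k % 6 : ℤ) : ℝ) := by
    exact_mod_cast congrArg (Int.cast : ℤ → ℝ) (Int.toNat_of_nonneg h0)
  have hk : (k : ℝ) = ((k % 6 : ℤ) : ℝ) + 6 * ((k / 6 : ℤ) : ℝ) := by
    exact_mod_cast (Int.emod_add_mul_ediv k 6).symm
  have hang : φ + k * (Real.pi / 3)
      = φ + ((k % 6 : ℤ) : ℝ) * (Real.pi / 3) + ((k / 6 : ℤ) : ℝ) * (2 * Real.pi) := by
    rw [hk]; ring
  simp only [hexVertex, unitVec, hcast]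
  rw [hang, Real.cos_add_int_mul_two_pi, Real.sin_add_int_mul_two_pi]

theorem hexVertex_eq (X : Plane) (s φ : ℝ) (j : Fin 6) :
    hexVertex X s φ j = X + s • unitVec (φ + ((j : ℕ) : ℤ) * (Real.pi / 3)) := by
  simp [hexVertex, unitVec]

theorem convex_regularHexagon (X : Plane) (s φ : ℝ) : Convex ℝ (regularHexagon X s φ) :=
  convex_convexHull _ _

theorem isClosed_regularHexagon (X : Plane) (s φ : ℝ) : IsClosed (regularHexagon X s φ) :=
  ((Set.finite_range (hexVertex X s φ)).isCompact_convexHull (𝕜 := ℝ)).isClosed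

theorem unitVec_add_pi (α : ℝ) : unitVec (α + Real.pi) = -unitVec α := by
  ext i
  fin_cases i <;> simp [unitVec]

theorem center_mem_regularHexagon (X : Plane) (s φ : ℝ) : X ∈ regularHexagon X s φ := by
  obtain ⟨i, hi⟩ := exists_hexVertex_eq X s φ 0
  obtain ⟨j, hj⟩ := exists_hexVertex_eq X s φ 3
  have hang : φ + ((3 : ℤ) : ℝ) * (Real.pi / 3) = φ + Real.pi := by push_cast; ring
  rw [hang, unitVec_add_pi] at hj
  have h := convex_regularHexagon X s φ (subset_convexHull ℝ _ ⟨i, rfl⟩)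
    (subset_convexHull ℝ _ ⟨j, rfl⟩) (a := 1 / 2) (b := 1 / 2)
    (by norm_num) (by norm_num) (by norm_num)
  rw [hi, hj] at h
  convert h using 1
  simp only [Int.cast_zero, zero_mul, add_zero]
  module

/-- The strip of half-width `w` whose centre line passes through `X` and is orthogonal to the
direction of angle `ω`. -/
def strip (X : Plane) (ω w : ℝ) : Set Plane :=
  {p | |(p 0 - X 0) * Real.cos ω + (p 1 - X 1) * Real.sin ω| ≤ w}

theorem convex_strip (X : Plane) (ω w : ℝ) : Convex ℝ (strip X ω w) := by
  intro p hp q hq a b ha hb hab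
  simp only [strip, Set.mem_ofPred_eq, PiLp.add_apply, PiLp.smul_apply, smul_eq_mul] at *
  have hX : ∀ t : ℝ, t = a * t + b * t := fun t => by rw [← add_mul, hab, one_mul]
  calc |(a * p 0 + b * q 0 - X 0) * Real.cos ω + (a * p 1 + b * q 1 - X 1) * Real.sin ω|
      = |a * ((p 0 - X 0) * Real.cos ω + (p 1 - X 1) * Real.sin ω)
          + b * ((q 0 - X 0) * Real.cos ω + (q 1 - X 1) * Real.sin ω)| := by
        congr 1
        linear_combination -(Real.cos ω * hX (X 0)) - Real.sin ω * hX (X 1)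
    _ ≤ a * |(p 0 - X 0) * Real.cos ω + (p 1 - X 1) * Real.sin ω|
          + b * |(q 0 - X 0) * Real.cos ω + (q 1 - X 1) * Real.sin ω| := by
        refine (abs_add_le _ _).trans_eq ?_
        rw [abs_mul, abs_mul, abs_of_nonneg ha, abs_of_nonneg hb]
    _ ≤ a * w + b * w := by gcongr
    _ = w := (hX w).symm

theorem add_smul_unitVec_mem_strip (X : Plane) (ω w r α : ℝ) :
    X + r • unitVec α ∈ strip X ω w ↔ |r * Real.cos (α - ω)| ≤ w := by
  simp only [strip, Set.mem_ofPred_eq, unitVec, PiLp.add_apply, PiLp.smul_apply, smul_eq_mul,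
    Matrix.cons_val_zero, Matrix.cons_val_one, Real.cos_sub, add_sub_cancel_left]
  rw [mul_add, mul_assoc, mul_assoc]

/-- A point belongs to the three strips spanned by the pairs of opposite sides of the hexagon
of side `s` (of half-width `s * √3 / 2`) if and only if `r² maxCosSq ≤ 3 s² / 4`. -/
theorem mem_strips_iff (X : Plane) {s φ r α : ℝ} (hs : 0 ≤ s) :
    (X + r • unitVec α ∈ strip X (φ + Real.pi / 6) (s * √3 / 2) ∧
      X + r • unitVec α ∈ strip X (φ - Real.pi / 6) (s * √3 / 2) ∧
      X + r • unitVec α ∈ strip X (φ + Real.pi / 2) (s * √3 / 2)) ↔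
    r ^ 2 * maxCosSq (α - φ) ≤ 3 / 4 * s ^ 2 := by
  have hs3 : √3 ^ 2 = 3 := Real.sq_sqrt (by norm_num)
  have hw : 0 ≤ s * √3 / 2 := by positivity
  have key : ∀ x : ℝ, |r * x| ≤ s * √3 / 2 ↔ r ^ 2 * x ^ 2 ≤ 3 / 4 * s ^ 2 := by
    intro x
    rw [← abs_of_nonneg hw, ← sq_le_sq, mul_pow]
    have : (s * √3 / 2) ^ 2 = 3 / 4 * s ^ 2 := by
      linear_combination s ^ 2 / 4 * hs3
    rw [this]
  have h1 : α - (φ + Real.pi / 6) = α - φ - Real.pi / 6 := by ring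
  have h2 : α - (φ - Real.pi / 6) = α - φ + Real.pi / 6 := by ring
  have h3 : α - (φ + Real.pi / 2) = α - φ - Real.pi / 2 := by ring
  simp only [add_smul_unitVec_mem_strip, h1, h2, h3, Real.cos_sub_pi_div_two, key, maxCosSq]
  rw [mul_max_of_nonneg _ _ (sq_nonneg r), mul_max_of_nonneg _ _ (sq_nonneg r), max_le_iff,
    max_le_iff, and_assoc]

theorem maxCosSq_int_mul (k : ℤ) : maxCosSq (k * (Real.pi / 3)) = 3 / 4 := by
  have hs3 : √3 ^ 2 = 3 := Real.sq_sqrt (by norm_num)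
  have h := periodic_maxCosSq.int_mul k 0
  rw [zero_add] at h
  rw [h, maxCosSq_eq le_rfl (by positivity), zero_sub, Real.cos_neg, Real.cos_pi_div_six]
  linear_combination hs3 / 4

/-- The regular hexagon in polar coordinates about its centre. -/
theorem mem_regularHexagon_iff (X : Plane) {s φ r α : ℝ} (hs : 0 < s) (hr : 0 ≤ r) :
    X + r • unitVec α ∈ regularHexagon X s φ ↔ r ^ 2 * maxCosSq (α - φ) ≤ 3 / 4 * s ^ 2 := by
  constructor
  · intro h
    rw [← mem_strips_iff X hs.le]
    have hsub : regularHexagon X s φ ⊆ strip X (φ + Real.pi / 6) (s * √3 / 2) ∩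
        (strip X (φ - Real.pi / 6) (s * √3 / 2) ∩ strip X (φ + Real.pi / 2) (s * √3 / 2)) := by
      refine convexHull_min ?_
        ((convex_strip _ _ _).inter ((convex_strip _ _ _).inter (convex_strip _ _ _)))
      rintro _ ⟨j, rfl⟩
      rw [hexVertex_eq]
      refine (mem_strips_iff X hs.le).2 ?_
      rw [add_sub_cancel_left, maxCosSq_int_mul, mul_comm]
    exact hsub h
  · intro h
    obtain ⟨k, y, h0, h1, hk⟩ := exists_int_mul_pi_div_three_add (α - φ)
    rw [hk, periodic_maxCosSq.int_mul k y, maxCosSq_eq h0 h1] at h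
    obtain ⟨i, hi⟩ := exists_hexVertex_eq X s φ k
    obtain ⟨j, hj⟩ := exists_hexVertex_eq X s φ (k + 1)
    have hs3 : √3 ^ 2 = 3 := Real.sq_sqrt (by norm_num)
    have hpi := Real.pi_pos
    have hle : r * Real.cos (y - Real.pi / 6) ≤ s * √3 / 2 := by
      refine le_of_sq_le_sq ?_ (by positivity)
      have : (s * √3 / 2) ^ 2 = 3 / 4 * s ^ 2 := by linear_combination s ^ 2 / 4 * hs3
      rw [this, mul_pow]
      exact h
    have hsin1 : 0 ≤ Real.sin y := Real.sin_nonneg_of_nonneg_of_le_pi h0 (by linarith)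
    have hsin2 : 0 ≤ Real.sin (Real.pi / 3 - y) :=
      Real.sin_nonneg_of_nonneg_of_le_pi (by linarith) (by linarith)
    -- coordinates of the point in the basis formed by the two nearest vertices
    set a : ℝ := r * Real.sin (Real.pi / 3 - y) / (s * (√3 / 2)) with ha
    set b : ℝ := r * Real.sin y / (s * (√3 / 2)) with hb
    have ha0 : 0 ≤ a := by positivity
    have hb0 : 0 ≤ b := by positivity
    have hab : a + b ≤ 1 := by
      rw [ha, hb, ← add_div, div_le_one (by positivity), ← mul_add]
      have : Real.sin (Real.pi / 3 - y) + Real.sin y = Real.cos (y - Real.pi / 6) := by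
        rw [Real.sin_sub, Real.cos_sub, Real.sin_pi_div_three, Real.cos_pi_div_three,
          Real.sin_pi_div_six, Real.cos_pi_div_six]
        ring
      rw [this]
      linarith
    have hmi : hexVertex X s φ i ∈ regularHexagon X s φ := subset_convexHull ℝ _ ⟨i, rfl⟩
    have hmj : hexVertex X s φ j ∈ regularHexagon X s φ := subset_convexHull ℝ _ ⟨j, rfl⟩
    have hcomb := (convex_regularHexagon X s φ).sum_mem (t := Finset.univ)
      (w := ![1 - a - b, a, b]) (z := ![X, hexVertex X s φ i, hexVertex X s φ j])
      (by
        intro l _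
        fin_cases l
        · simp; linarith
        · simpa using ha0
        · simpa using hb0)
      (by simp only [Fin.sum_univ_three, Matrix.cons_val_zero, Matrix.cons_val_one,
            Matrix.cons_val]; ring)
      (by
        intro l _
        fin_cases l
        · simpa using center_mem_regularHexagon X s φ
        · simpa using hmi
        · simpa using hmj)
    simp only [Fin.sum_univ_three, Matrix.cons_val_zero, Matrix.cons_val_one,
      Matrix.cons_val] at hcomb
    convert hcomb using 1
    set β : ℝ := φ + k * (Real.pi / 3) with hβ
    have hang1 : α = β + y := by rw [hβ]; linarith
    have hang2 : φ + ((k + 1 : ℤ) : ℝ) * (Real.pi / 3) = β + Real.pi / 3 := by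
      rw [hβ]; push_cast; ring
    rw [hi, hj, hang2, hang1]
    have has : a * s = r * (Real.cos y - Real.sin y / √3) := by
      rw [ha, Real.sin_sub, Real.sin_pi_div_three, Real.cos_pi_div_three]
      field_simp
    have hbs : b * s = r * (2 * Real.sin y / √3) := by
      rw [hb]
      field_simp
    have hinv : √3 * (1 / √3) = 1 := by field_simp
    clear_value a b β
    ext l
    fin_cases l
    · simp only [unitVec, PiLp.add_apply, PiLp.smul_apply, smul_eq_mul, Fin.zero_eta,
        Matrix.cons_val_zero, Real.cos_add, Real.cos_pi_div_three, Real.sin_pi_div_three]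
      linear_combination -(Real.cos β) * has - (Real.cos β / 2 - Real.sin β * √3 / 2) * hbs
        + r * Real.sin y * Real.sin β * hinv
    · simp only [unitVec, PiLp.add_apply, PiLp.smul_apply, smul_eq_mul, Fin.mk_one,
        Matrix.cons_val_one, Matrix.cons_val_fin_one, Real.sin_add, Real.cos_pi_div_three,
        Real.sin_pi_div_three]
      linear_combination -(Real.sin β) * has - (Real.sin β / 2 + Real.cos β * √3 / 2) * hbs
        - r * Real.sin y * Real.cos β * hinv

theorem unitDisk_center_subset_regularHexagon (X : Plane) (φ : ℝ) :
    unitDisk X ⊆ regularHexagon X (4 / 3) φ := by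
  intro p hp
  obtain ⟨α, hα⟩ := exists_eq_add_smul_unitVec X p
  rw [unitDisk, Metric.mem_closedBall] at hp
  rw [hα, mem_regularHexagon_iff X (by norm_num) dist_nonneg]
  have h1 : dist p X ^ 2 ≤ 1 := pow_le_one₀ dist_nonneg hp
  have h2 := mul_le_mul h1 (maxCosSq_le_one (α - φ)) (by linarith [maxCosSq_ge (α - φ)])
    zero_le_one
  linarith

/-! ### Unit disks with the centre of the hexagon on the boundary -/

/-- The square of the radial function, about the origin, of the unit disk with centre `unitVec 0`.
The disk lies in a half-plane bounded by its tangent at the origin, so the value is `0` in the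
directions with negative cosine. -/
noncomputable def diskRadialSq (x : ℝ) : ℝ := (2 * max (Real.cos x) 0) ^ 2

theorem mem_unitDisk_iff (X : Plane) {ψ r α : ℝ} (hr : 0 < r) :
    X + r • unitVec α ∈ unitDisk (X + unitVec ψ) ↔ r ^ 2 ≤ diskRadialSq (α - ψ) := by
  have h1 : X + r • unitVec α ∈ unitDisk (X + unitVec ψ) ↔ r ≤ 2 * Real.cos (α - ψ) := by
    rw [unitDisk, Metric.mem_closedBall, EuclideanSpace.dist_eq, Real.sqrt_le_one]
    simp only [Fin.sum_univ_two, Real.dist_eq, sq_abs, unitVec, PiLp.add_apply, PiLp.smul_apply,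
      smul_eq_mul, Matrix.cons_val_zero, Matrix.cons_val_one, add_sub_add_left_eq_sub,
      Real.cos_sub]
    have ha := Real.sin_sq_add_cos_sq α
    have hp := Real.sin_sq_add_cos_sq ψ
    have : (r * Real.cos α - Real.cos ψ) ^ 2 + (r * Real.sin α - Real.sin ψ) ^ 2
        = r * (r - 2 * (Real.cos α * Real.cos ψ + Real.sin α * Real.sin ψ)) + 1 := by
      linear_combination r ^ 2 * ha + hp
    rw [this]
    constructor
    · intro h
      by_contra! hc
      nlinarith [mul_pos hr (sub_pos.2 hc)]
    · intro h
      nlinarith [mul_nonneg hr.le (sub_nonneg.2 h)]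
  rw [h1, diskRadialSq]
  constructor
  · intro h
    exact pow_le_pow_left₀ hr.le (h.trans (by linarith [le_max_left (Real.cos (α - ψ)) 0])) 2
  · intro h
    have h2 := le_of_sq_le_sq h (by positivity)
    rcases max_cases (Real.cos (α - ψ)) 0 with ⟨hm, _⟩ | ⟨hm, _⟩ <;> rw [hm] at h2 <;> linarith

theorem continuous_diskRadialSq : Continuous diskRadialSq := by
  unfold diskRadialSq
  fun_prop

theorem diskRadialSq_neg (x : ℝ) : diskRadialSq (-x) = diskRadialSq x := by
  simp [diskRadialSq]

theorem periodic_diskRadialSq : Function.Periodic diskRadialSq (2 * Real.pi) := by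
  intro x
  simp [diskRadialSq]

/-- The square of the radial function, about the centre, of the hexagon of side `4 / 3`
with a vertex in the direction of angle `0`. -/
noncomputable def hexRadialSq (x : ℝ) : ℝ := 4 / 3 / maxCosSq x

theorem continuous_hexRadialSq : Continuous hexRadialSq :=
  continuous_const.div continuous_maxCosSq fun x => by linarith [maxCosSq_ge x]

theorem periodic_hexRadialSq : Function.Periodic hexRadialSq (Real.pi / 3) := by
  intro x
  rw [hexRadialSq, periodic_maxCosSq x, hexRadialSq]

theorem hexRadialSq_neg (x : ℝ) : hexRadialSq (-x) = hexRadialSq x := by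
  rw [hexRadialSq, maxCosSq_neg, hexRadialSq]

theorem hexRadialSq_ge (x : ℝ) : 4 / 3 ≤ hexRadialSq x := by
  have := maxCosSq_ge x
  rw [hexRadialSq, le_div_iff₀ (by linarith)]
  linarith [maxCosSq_le_one x]

theorem hexRadialSq_le (x : ℝ) : hexRadialSq x ≤ 16 / 9 := by
  have := maxCosSq_ge x
  rw [hexRadialSq, div_le_iff₀ (by linarith)]
  linarith

/-- The area of the intersection of the hexagon with a unit disk that has the centre of the
hexagon on its boundary, as a function of the angle `θ` between the centre of the disk and a
vertex. -/
noncomputable def boundaryArea (θ : ℝ) : ℝ :=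
  1 / 2 * ∫ α in (-Real.pi)..Real.pi, min (hexRadialSq (α + θ)) (diskRadialSq α)

theorem area_inter_eq_boundaryArea (X : Plane) (φ ψ : ℝ) :
    area (regularHexagon X (4 / 3) φ ∩ unitDisk (X + unitVec ψ)) = boundaryArea (ψ - φ) := by
  have hcont : Continuous fun α => min (hexRadialSq (α - φ)) (diskRadialSq (α - ψ)) :=
    (continuous_hexRadialSq.comp (by fun_prop)).min (continuous_diskRadialSq.comp (by fun_prop))
  rw [area_eq_integral_radial (X := X)
    (ρ := fun α => min (hexRadialSq (α - φ)) (diskRadialSq (α - ψ))) _ hcont, boundaryArea]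
  · congr 1
    have hper : Function.Periodic
        (fun α => min (hexRadialSq (α - φ)) (diskRadialSq (α - ψ))) (2 * Real.pi) := by
      intro α
      have e1 : hexRadialSq (α + 2 * Real.pi - φ) = hexRadialSq (α - φ) := by
        have := periodic_hexRadialSq.int_mul 6 (α - φ)
        rw [← this]
        congr 1
        push_cast
        ring
      have e2 : diskRadialSq (α + 2 * Real.pi - ψ) = diskRadialSq (α - ψ) := by
        rw [← periodic_diskRadialSq (α - ψ)]
        congr 1
        ring
      simp only [e1, e2]
    have hshift := hper.intervalIntegral_add_eq (-Real.pi) (-Real.pi + ψ)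
    have e3 : -Real.pi + 2 * Real.pi = Real.pi := by ring
    have e4 : -Real.pi + ψ + 2 * Real.pi = Real.pi + ψ := by ring
    rw [e3, e4] at hshift
    rw [hshift, ← intervalIntegral.integral_comp_add_right]
    refine intervalIntegral.integral_congr fun α _ => ?_
    simp only [add_sub_cancel_right, add_sub_assoc]
  · intro α
    exact le_min (by linarith [hexRadialSq_ge (α - φ)]) (by unfold diskRadialSq; positivity)
  · intro r α hr
    have := maxCosSq_ge (α - φ)
    rw [Set.mem_inter_iff, mem_regularHexagon_iff X (by norm_num) hr.le, mem_unitDisk_iff X hr,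
      le_min_iff, hexRadialSq, le_div_iff₀ (by linarith)]
    norm_num
  · exact (isClosed_regularHexagon X _ φ).measurableSet.inter
      Metric.isClosed_closedBall.measurableSet

/-! ### Moving the disk outwards -/

/-- Moving a unit disk straight towards the centre of the hexagon does not decrease the area of the
intersection. -/
theorem area_inter_unitDisk_add_le (X : Plane) (φ : ℝ) (u : Plane) {t : ℝ} (ht0 : 0 ≤ t)
    (ht1 : t ≤ 1) :
    area (regularHexagon X (4 / 3) φ ∩ unitDisk (X + u)) ≤
      area (regularHexagon X (4 / 3) φ ∩ unitDisk (X + t • u)) := by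
  have hsub : regularHexagon X (4 / 3) φ ∩ unitDisk (X + u) ⊆
      (fun p => p + -((1 - t) • u)) ⁻¹'
        (regularHexagon X (4 / 3) φ ∩ unitDisk (X + t • u)) := by
    rintro p ⟨hp, hpd⟩
    rw [unitDisk, Metric.mem_closedBall, dist_eq_norm] at hpd
    constructor
    · have hp' : p - u ∈ regularHexagon X (4 / 3) φ := by
        apply unitDisk_center_subset_regularHexagon
        rw [unitDisk, Metric.mem_closedBall, dist_eq_norm]
        convert hpd using 2
        abel
      have := convex_regularHexagon X (4 / 3) φ hp hp' ht0 (sub_nonneg.2 ht1) (by ring)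
      convert this using 1
      module
    · rw [unitDisk, Metric.mem_closedBall, dist_eq_norm]
      convert hpd using 2
      module
  have hfin : MeasureTheory.volume (regularHexagon X (4 / 3) φ ∩ unitDisk (X + t • u)) ≠ ⊤ :=
    ((MeasureTheory.measure_mono Set.inter_subset_right).trans_lt
      MeasureTheory.measure_closedBall_lt_top).ne
  refine ENNReal.toReal_mono hfin ?_
  refine (MeasureTheory.measure_mono hsub).trans_eq ?_
  exact MeasureTheory.measure_preimage_add_right _ _ _

/-! ### The crossing point in the extremal position -/

/-- The angle whose cosine is `√3 / 6`. For the angle `α` of the crossing point the equation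
`4 cos² α * cos² (α - π / 6) = 4 / 3` amounts to `cos (2 * α - π / 6) = √3 / 6`. -/
noncomputable def auxAngle : ℝ := Real.arccos (√3 / 6)

theorem cos_auxAngle : Real.cos auxAngle = √3 / 6 := by
  have hs3 : √3 ^ 2 = 3 := Real.sq_sqrt (by norm_num)
  have h3 : 0 ≤ √3 := Real.sqrt_nonneg 3
  exact Real.cos_arccos (by linarith) (by nlinarith)

theorem sqrt_thirtyThree : √33 = √11 * √3 := by
  rw [← Real.sqrt_mul (by norm_num)]; norm_num

theorem sin_auxAngle : Real.sin auxAngle = √11 * √3 / 6 := by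
  rw [auxAngle, Real.sin_arccos, ← sqrt_thirtyThree,
    Real.sqrt_eq_iff_mul_self_eq (by norm_num [div_pow]) (by positivity)]
  have hs3 : √3 ^ 2 = 3 := Real.sq_sqrt (by norm_num)
  have hs33 : √33 ^ 2 = 33 := Real.sq_sqrt (by norm_num)
  linear_combination -hs33 / 36 - hs3 / 36

theorem auxAngle_lt : auxAngle < Real.pi / 2 :=
  Real.arccos_lt_pi_div_two.2 (by positivity)

theorem lt_auxAngle : Real.pi / 6 < auxAngle := by
  by_contra! h
  have h2 := Real.cos_le_cos_of_nonneg_of_le_pi (Real.arccos_nonneg _)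
    (by linarith [Real.pi_pos]) h
  rw [← auxAngle, cos_auxAngle, Real.cos_pi_div_six] at h2
  have : 0 < √3 := by positivity
  linarith

/-- The angle, seen from the common point `X`, between the centre of the disk and the point where
its boundary crosses the boundary of the hexagon, when the centre lies in the direction of a
vertex. -/
noncomputable def crossAngle : ℝ := auxAngle / 2 + Real.pi / 12

theorem lt_crossAngle : Real.pi / 6 < crossAngle := by
  unfold crossAngle; linarith [lt_auxAngle]

theorem crossAngle_lt : crossAngle < Real.pi / 3 := by
  unfold crossAngle; linarith [auxAngle_lt]

theorem cos_crossAngle_mul : Real.cos crossAngle * Real.cos (crossAngle - Real.pi / 6) = √3 / 3 := by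
  have h1 : auxAngle = crossAngle + (crossAngle - Real.pi / 6) := by unfold crossAngle; ring
  have h2 : Real.pi / 6 = crossAngle - (crossAngle - Real.pi / 6) := by ring
  have e1 := cos_auxAngle
  have e2 := Real.cos_pi_div_six
  rw [h1, Real.cos_add] at e1
  rw [h2, Real.cos_sub] at e2
  linarith

theorem hexRadialSq_eq {x : ℝ} (h0 : 0 ≤ x) (h1 : x ≤ Real.pi / 3) :
    hexRadialSq x = 4 / 3 / Real.cos (x - Real.pi / 6) ^ 2 := by
  rw [hexRadialSq, maxCosSq_eq h0 h1]

theorem diskRadialSq_eq {x : ℝ} (h0 : 0 ≤ x) (h1 : x ≤ Real.pi / 2) :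
    diskRadialSq x = 4 * Real.cos x ^ 2 := by
  rw [diskRadialSq, max_eq_left
    (Real.cos_nonneg_of_neg_pi_div_two_le_of_le (by linarith [Real.pi_pos]) h1)]
  ring

theorem hexRadialSq_crossAngle : hexRadialSq crossAngle = diskRadialSq crossAngle := by
  have hpi := Real.pi_pos
  have h1 := lt_crossAngle
  have h2 := crossAngle_lt
  have hge := cos_sub_pi_div_six_ge (x := crossAngle) (by linarith) h2.le
  have hpos : 0 < Real.cos (crossAngle - Real.pi / 6) := lt_of_lt_of_le (by positivity) hge
  rw [hexRadialSq_eq (by linarith) h2.le, diskRadialSq_eq (by linarith) (by linarith),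
    div_eq_iff (by positivity)]
  have hs3 : √3 ^ 2 = 3 := Real.sq_sqrt (by norm_num)
  have := cos_crossAngle_mul
  rw [mul_assoc, ← mul_pow, this]
  linear_combination -4 / 9 * hs3

theorem diskRadialSq_anti {x y : ℝ} (h0 : 0 ≤ x) (hxy : x ≤ y) (hy : y ≤ Real.pi) :
    diskRadialSq y ≤ diskRadialSq x := by
  have := Real.cos_le_cos_of_nonneg_of_le_pi h0 hy hxy
  unfold diskRadialSq
  gcongr

theorem hexRadialSq_mono {x y : ℝ} (h0 : Real.pi / 6 ≤ x) (hxy : x ≤ y) (hy : y ≤ Real.pi / 3) :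
    hexRadialSq x ≤ hexRadialSq y := by
  have hpi := Real.pi_pos
  have hge := cos_sub_pi_div_six_ge (x := y) (by linarith) hy
  have hpos : 0 < Real.cos (y - Real.pi / 6) := lt_of_lt_of_le (by positivity) hge
  rw [hexRadialSq_eq (by linarith) (by linarith), hexRadialSq_eq (by linarith) hy]
  have := Real.cos_le_cos_of_nonneg_of_le_pi (x := x - Real.pi / 6) (y := y - Real.pi / 6)
    (by linarith) (by linarith) (by linarith)
  gcongr

theorem three_le_diskRadialSq {x : ℝ} (h0 : 0 ≤ x) (h1 : x ≤ Real.pi / 6) : 3 ≤ diskRadialSq x := by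
  have hpi := Real.pi_pos
  refine le_trans (le_of_eq ?_) (diskRadialSq_anti h0 h1 (by linarith))
  have hs3 : √3 ^ 2 = 3 := Real.sq_sqrt (by norm_num)
  rw [diskRadialSq_eq (by positivity) (by linarith), Real.cos_pi_div_six]
  linear_combination -hs3

theorem diskRadialSq_le_one {x : ℝ} (h0 : Real.pi / 3 ≤ x) (h1 : x ≤ Real.pi) :
    diskRadialSq x ≤ 1 := by
  have hpi := Real.pi_pos
  refine (diskRadialSq_anti (by positivity) h0 h1).trans (le_of_eq ?_)
  rw [diskRadialSq_eq (by positivity) (by linarith), Real.cos_pi_div_three]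
  norm_num

theorem min_eq_of_le_pi_div_six {x : ℝ} (y : ℝ) (h0 : 0 ≤ x) (h1 : x ≤ Real.pi / 6) :
    min (hexRadialSq y) (diskRadialSq x) = hexRadialSq y :=
  min_eq_left (by linarith [hexRadialSq_le y, three_le_diskRadialSq h0 h1])

theorem min_eq_of_pi_div_three_le {x : ℝ} (y : ℝ) (h0 : Real.pi / 3 ≤ x) (h1 : x ≤ Real.pi) :
    min (hexRadialSq y) (diskRadialSq x) = diskRadialSq x :=
  min_eq_right (by linarith [hexRadialSq_ge y, diskRadialSq_le_one h0 h1])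

theorem hexRadialSq_le_cross {x : ℝ} (h0 : Real.pi / 6 ≤ x) (h1 : x ≤ crossAngle) :
    hexRadialSq x ≤ diskRadialSq crossAngle ∧ diskRadialSq crossAngle ≤ diskRadialSq x := by
  have hpi := Real.pi_pos
  have h2 := crossAngle_lt
  rw [← hexRadialSq_crossAngle]
  refine ⟨hexRadialSq_mono h0 h1 h2.le, ?_⟩
  rw [hexRadialSq_crossAngle]
  exact diskRadialSq_anti (by linarith) h1 (by linarith)

theorem diskRadialSq_le_cross {x : ℝ} (h0 : crossAngle ≤ x) (h1 : x ≤ Real.pi / 3) :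
    diskRadialSq x ≤ diskRadialSq crossAngle ∧ diskRadialSq crossAngle ≤ hexRadialSq x := by
  have hpi := Real.pi_pos
  have h2 := lt_crossAngle
  refine ⟨diskRadialSq_anti (by linarith) h0 (by linarith), ?_⟩
  rw [← hexRadialSq_crossAngle]
  exact hexRadialSq_mono h2.le h0 h1

/-! ### Minimality of the extremal position -/

/-- The square of the radial function of the part of the hexagon inside the circle about its centre
through the two points where the boundaries of disk and hexagon cross in the extremal position. -/
noncomputable def cutRadialSq (x : ℝ) : ℝ := min (hexRadialSq x) (diskRadialSq crossAngle)

theorem continuous_cutRadialSq : Continuous cutRadialSq :=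
  continuous_hexRadialSq.min continuous_const

theorem periodic_cutRadialSq : Function.Periodic cutRadialSq (Real.pi / 3) := by
  intro x
  rw [cutRadialSq, periodic_hexRadialSq x, cutRadialSq]

theorem cutRadialSq_neg (x : ℝ) : cutRadialSq (-x) = cutRadialSq x := by
  rw [cutRadialSq, hexRadialSq_neg, cutRadialSq]

/-- The pointwise estimate behind the minimality: the part of the hexagon outside the disk is
covered by the part of the hexagon outside the auxiliary circle and the part of the inside of
that circle outside the disk, and this cover is exact in the extremal position. -/
theorem cutRadialSq_sub_le {x : ℝ} (y : ℝ) (h0 : Real.pi / 6 ≤ x) (h1 : x ≤ Real.pi / 3) :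
    cutRadialSq y - cutRadialSq x ≤
      min (hexRadialSq y) (diskRadialSq x) - min (hexRadialSq x) (diskRadialSq x) := by
  unfold cutRadialSq
  set l := diskRadialSq crossAngle
  rcases le_total x crossAngle with h | h
  · obtain ⟨h2, h3⟩ := hexRadialSq_le_cross h0 h
    rw [min_eq_left h2, min_eq_left (h2.trans h3)]
    gcongr
  · obtain ⟨h2, h3⟩ := diskRadialSq_le_cross h h1
    rw [min_eq_right h3, min_eq_right (h2.trans h3)]
    rcases min_cases (hexRadialSq y) l with ⟨h4, _⟩ | ⟨h4, _⟩ <;>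
    rcases min_cases (hexRadialSq y) (diskRadialSq x) with ⟨h5, _⟩ | ⟨h5, _⟩ <;>
    rw [h4, h5] <;> linarith

theorem integral_shift_sub_eq_zero {g : ℝ → ℝ} {T : ℝ} (hg : Continuous g)
    (hper : Function.Periodic g T) (a θ : ℝ) :
    ∫ x in a..(a + T), (g (x + θ) - g x) = 0 := by
  rw [intervalIntegral.integral_sub
    ((by fun_prop : Continuous fun x => g (x + θ)).intervalIntegrable _ _) (hg.intervalIntegrable _ _), intervalIntegral.integral_comp_add_right, sub_eq_zero]
  have := hper.intervalIntegral_add_eq (a + θ) a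
  rw [← this]
  congr 1
  ring

/-- Among the disks with the centre of the hexagon on the boundary, those centred in the direction
of a vertex have the smallest intersection with the hexagon. -/
theorem boundaryArea_zero_le (θ : ℝ) : boundaryArea 0 ≤ boundaryArea θ := by
  have hpi := Real.pi_pos
  have hS := continuous_hexRadialSq
  have hc := continuous_diskRadialSq
  have hp := continuous_cutRadialSq
  set D : ℝ → ℝ := fun α => min (hexRadialSq (α + θ)) (diskRadialSq α)
    - min (hexRadialSq α) (diskRadialSq α) with hD
  have hm : ∀ t : ℝ, Continuous fun α => min (hexRadialSq (α + t)) (diskRadialSq α) :=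
    fun t => (hS.comp (by fun_prop)).min hc
  have hm0 : Continuous fun α => min (hexRadialSq α) (diskRadialSq α) := hS.min hc
  have hDc : Continuous D := (hm θ).sub hm0
  have hDi : ∀ a b : ℝ, IntervalIntegrable D MeasureTheory.volume a b :=
    fun a b => hDc.intervalIntegrable a b
  have hdiff : boundaryArea θ - boundaryArea 0 = 1 / 2 * ∫ α in (-Real.pi)..Real.pi, D α := by
    simp only [boundaryArea, add_zero, hD]
    rw [intervalIntegral.integral_sub ((hm θ).intervalIntegrable _ _)
      (hm0.intervalIntegrable _ _)]
    ring
  -- evenness reduces the negative angles to positive ones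
  have hDabs : ∀ α : ℝ, D α = min (hexRadialSq (α + θ)) (diskRadialSq |α|)
      - min (hexRadialSq |α|) (diskRadialSq |α|) := by
    intro α
    rcases abs_choice α with h | h <;> rw [h]
    simp only [hD, hexRadialSq_neg, diskRadialSq_neg]
  have houter : ∀ α : ℝ, Real.pi / 3 ≤ |α| → |α| ≤ Real.pi → D α = 0 := by
    intro α h1 h2
    rw [hDabs, min_eq_of_pi_div_three_le _ h1 h2, min_eq_of_pi_div_three_le _ h1 h2, sub_self]
  have h1 : ∫ α in (-Real.pi)..(-(Real.pi / 3)), D α = 0 := by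
    rw [intervalIntegral.integral_congr (g := fun _ => (0 : ℝ)), intervalIntegral.integral_zero]
    intro α hα
    rw [Set.uIcc_of_le (by linarith)] at hα
    have habs : |α| = -α := abs_of_nonpos (by linarith [hα.2])
    exact houter α (by rw [habs]; linarith [hα.2]) (by rw [habs]; linarith [hα.1])
  have h5 : ∫ α in (Real.pi / 3)..Real.pi, D α = 0 := by
    rw [intervalIntegral.integral_congr (g := fun _ => (0 : ℝ)), intervalIntegral.integral_zero]
    intro α hα
    rw [Set.uIcc_of_le (by linarith)] at hα
    have habs : |α| = α := abs_of_nonneg (by linarith [hα.1])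
    exact houter α (by rw [habs]; exact hα.1) (by rw [habs]; exact hα.2)
  have h3 : ∫ α in (-(Real.pi / 6))..(Real.pi / 6), D α = 0 := by
    rw [← integral_shift_sub_eq_zero hS periodic_hexRadialSq (-(Real.pi / 6)) θ]
    have e : -(Real.pi / 6) + Real.pi / 3 = Real.pi / 6 := by ring
    rw [e]
    refine intervalIntegral.integral_congr fun α hα => ?_
    rw [Set.uIcc_of_le (by linarith)] at hα
    have habs : |α| ≤ Real.pi / 6 := abs_le.2 hα
    have heven : hexRadialSq |α| = hexRadialSq α := by
      rcases abs_choice α with h | h <;> rw [h]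
      exact hexRadialSq_neg α
    simp only [hDabs α]
    rw [min_eq_of_le_pi_div_six _ (abs_nonneg α) habs,
      min_eq_of_le_pi_div_six _ (abs_nonneg α) habs, heven]
  set q : ℝ → ℝ := fun α => cutRadialSq (α + θ) - cutRadialSq α with hq
  have hqc : Continuous q := by fun_prop
  have hqi : ∀ a b : ℝ, IntervalIntegrable q MeasureTheory.volume a b :=
    fun a b => hqc.intervalIntegrable a b
  have hqD : ∀ α : ℝ, Real.pi / 6 ≤ |α| → |α| ≤ Real.pi / 3 → q α ≤ D α := by
    intro α h1 h2
    have heven : cutRadialSq |α| = cutRadialSq α := by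
      rcases abs_choice α with h | h <;> rw [h]
      exact cutRadialSq_neg α
    rw [hDabs]
    simp only [hq]
    rw [← heven]
    exact cutRadialSq_sub_le _ h1 h2
  have h2 : ∫ α in (-(Real.pi / 3))..(-(Real.pi / 6)), q α
      ≤ ∫ α in (-(Real.pi / 3))..(-(Real.pi / 6)), D α := by
    refine intervalIntegral.integral_mono_on (by linarith) (hqi _ _) (hDi _ _) fun α hα => ?_
    have habs : |α| = -α := abs_of_nonpos (by linarith [hα.2])
    exact hqD α (by rw [habs]; linarith [hα.2]) (by rw [habs]; linarith [hα.1])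
  have h4 : ∫ α in (Real.pi / 6)..(Real.pi / 3), q α
      ≤ ∫ α in (Real.pi / 6)..(Real.pi / 3), D α := by
    refine intervalIntegral.integral_mono_on (by linarith) (hqi _ _) (hDi _ _) fun α hα => ?_
    have habs : |α| = α := abs_of_nonneg (by linarith [hα.1])
    exact hqD α (by rw [habs]; exact hα.1) (by rw [habs]; exact hα.2)
  -- the two sectors, one of them turned by `π / 3`, form a period of `q`
  have hshift : ∫ α in (-(Real.pi / 3))..(-(Real.pi / 6)), q α
      = ∫ α in (0 : ℝ)..(Real.pi / 6), q α := by
    have e1 : (0 : ℝ) = -(Real.pi / 3) + Real.pi / 3 := by ring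
    have e2 : Real.pi / 6 = -(Real.pi / 6) + Real.pi / 3 := by ring
    conv_rhs => rw [e1, e2]
    rw [← intervalIntegral.integral_comp_add_right]
    refine intervalIntegral.integral_congr fun α _ => ?_
    simp only [hq]
    rw [periodic_cutRadialSq α, add_right_comm, periodic_cutRadialSq (α + θ)]
  have hq0 : (∫ α in (0 : ℝ)..(Real.pi / 6), q α) + ∫ α in (Real.pi / 6)..(Real.pi / 3), q α = 0 := by
    rw [intervalIntegral.integral_add_adjacent_intervals (hqi _ _) (hqi _ _)]
    have := integral_shift_sub_eq_zero hp periodic_cutRadialSq 0 θ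
    rwa [zero_add] at this
  have hsplit : ∫ α in (-Real.pi)..Real.pi, D α =
      (∫ α in (-Real.pi)..(-(Real.pi / 3)), D α)
      + (∫ α in (-(Real.pi / 3))..(-(Real.pi / 6)), D α)
      + (∫ α in (-(Real.pi / 6))..(Real.pi / 6), D α)
      + (∫ α in (Real.pi / 6)..(Real.pi / 3), D α)
      + ∫ α in (Real.pi / 3)..Real.pi, D α := by
    rw [intervalIntegral.integral_add_adjacent_intervals (hDi _ _) (hDi _ _),
      intervalIntegral.integral_add_adjacent_intervals (hDi _ _) (hDi _ _),
      intervalIntegral.integral_add_adjacent_intervals (hDi _ _) (hDi _ _),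
      intervalIntegral.integral_add_adjacent_intervals (hDi _ _) (hDi _ _)]
  linarith

/-! ### The minimal area -/

theorem tan_crossAngle_sub : Real.tan (crossAngle - Real.pi / 6) = (√11 - √3) / 4 := by
  have hpi := Real.pi_pos
  have hs3 : √3 ^ 2 = 3 := Real.sq_sqrt (by norm_num)
  have hs11 : √11 ^ 2 = 11 := Real.sq_sqrt (by norm_num)
  have hge := cos_sub_pi_div_six_ge (x := crossAngle) (by linarith [lt_crossAngle])
    crossAngle_lt.le
  have hpos : 0 < Real.cos (crossAngle - Real.pi / 6) := lt_of_lt_of_le (by positivity) hge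
  have hdouble : auxAngle - Real.pi / 6 = 2 * (crossAngle - Real.pi / 6) := by
    unfold crossAngle; ring
  have hsin := Real.sin_two_mul (crossAngle - Real.pi / 6)
  have hcos := Real.cos_two_mul (crossAngle - Real.pi / 6)
  rw [← hdouble] at hsin hcos
  rw [Real.sin_sub, cos_auxAngle, sin_auxAngle, Real.cos_pi_div_six, Real.sin_pi_div_six] at hsin
  rw [Real.cos_sub, cos_auxAngle, sin_auxAngle, Real.cos_pi_div_six, Real.sin_pi_div_six] at hcos
  set s := Real.sin (crossAngle - Real.pi / 6)
  set c := Real.cos (crossAngle - Real.pi / 6)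
  rw [Real.tan_eq_sin_div_cos, div_eq_iff hpos.ne']
  -- multiplying by `2 c` turns the claim into a half-angle formula
  refine mul_right_cancel₀ (mul_pos two_pos hpos).ne' ?_
  linear_combination -hsin + (√11 - √3) / 4 * hcos + (√11 / 12 + √3 / 48) * hs3 - √3 / 48 * hs11

theorem arctan_eq_auxAngle :
    Real.arctan ((5 * √3 - √11) / (5 + √11 * √3)) = 2 * auxAngle - 2 * Real.pi / 3 := by
  have hpi := Real.pi_pos
  have hs3 : √3 ^ 2 = 3 := Real.sq_sqrt (by norm_num)
  have h23 : 2 * Real.pi / 3 = Real.pi - Real.pi / 3 := by ring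
  have hsin : Real.sin (2 * auxAngle - 2 * Real.pi / 3) = (5 * √3 - √11) / 12 := by
    rw [h23, Real.sin_sub, Real.sin_pi_sub, Real.cos_pi_sub, Real.sin_two_mul, Real.cos_two_mul,
      cos_auxAngle, sin_auxAngle, Real.cos_pi_div_three, Real.sin_pi_div_three]
    linear_combination (-√11 / 36 - √3 / 36) * hs3
  have hcos : Real.cos (2 * auxAngle - 2 * Real.pi / 3) = (5 + √11 * √3) / 12 := by
    rw [h23, Real.cos_sub, Real.sin_pi_sub, Real.cos_pi_sub, Real.sin_two_mul, Real.cos_two_mul,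
      cos_auxAngle, sin_auxAngle, Real.cos_pi_div_three, Real.sin_pi_div_three]
    linear_combination (-1 / 36 + √11 * √3 / 36) * hs3
  have htan : Real.tan (2 * auxAngle - 2 * Real.pi / 3) = (5 * √3 - √11) / (5 + √11 * √3) := by
    rw [Real.tan_eq_sin_div_cos, hsin, hcos]
    field_simp
  rw [← htan]
  exact Real.arctan_tan (by linarith [lt_auxAngle]) (by linarith [auxAngle_lt])

theorem minDiskHexArea_eq :
    minDiskHexArea = √3 / 36 + √11 / 12 + 5 * Real.pi / 6 - auxAngle := by
  rw [minDiskHexArea, arctan_eq_auxAngle]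
  ring

theorem boundaryArea_zero : boundaryArea 0 = minDiskHexArea := by
  have hpi := Real.pi_pos
  have hl := lt_crossAngle
  have hu := crossAngle_lt
  set m : ℝ → ℝ := fun α => min (hexRadialSq α) (diskRadialSq α) with hm
  have hmc : Continuous m := continuous_hexRadialSq.min continuous_diskRadialSq
  have hmi : ∀ a b : ℝ, IntervalIntegrable m MeasureTheory.volume a b :=
    fun a b => hmc.intervalIntegrable a b
  have hneg : ∫ α in (-Real.pi)..0, m α = ∫ α in (0 : ℝ)..Real.pi, m α := by
    have := intervalIntegral.integral_comp_neg (a := 0) (b := Real.pi) m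
    rw [neg_zero] at this
    rw [← this]
    refine intervalIntegral.integral_congr fun α _ => ?_
    simp only [hm, hexRadialSq_neg, diskRadialSq_neg]
  have h1 : ∫ α in (0 : ℝ)..crossAngle, m α = 4 / 3 * ((√11 - √3) / 4 + 1 / √3) := by
    have hcongr : ∫ α in (0 : ℝ)..crossAngle, m α
        = ∫ α in (0 : ℝ)..crossAngle, 4 / 3 * (1 / Real.cos (α - Real.pi / 6) ^ 2) := by
      refine intervalIntegral.integral_congr fun α hα => ?_
      rw [Set.uIcc_of_le (by linarith)] at hα
      have hle : m α = hexRadialSq α := by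
        rcases le_total α (Real.pi / 6) with h | h
        · exact min_eq_of_le_pi_div_six _ hα.1 h
        · obtain ⟨h2, h3⟩ := hexRadialSq_le_cross h hα.2
          exact min_eq_left (h2.trans h3)
      simp only [hle, hexRadialSq_eq hα.1 (hα.2.trans hu.le)]
      ring
    have hcos : ∀ α ∈ Set.uIcc 0 crossAngle, Real.cos (α - Real.pi / 6) ≠ 0 := by
      intro α hα
      rw [Set.uIcc_of_le (by linarith)] at hα
      exact (lt_of_lt_of_le (by positivity)
        (cos_sub_pi_div_six_ge hα.1 (hα.2.trans hu.le))).ne'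
    rw [hcongr, intervalIntegral.integral_const_mul,
      intervalIntegral.integral_eq_sub_of_hasDerivAt (f := fun α => Real.tan (α - Real.pi / 6))]
    · rw [tan_crossAngle_sub, zero_sub, Real.tan_neg, Real.tan_pi_div_six, sub_neg_eq_add]
    · intro α hα
      exact (Real.hasDerivAt_tan (hcos α hα)).comp_sub_const α (Real.pi / 6)
    · refine ContinuousOn.intervalIntegrable ?_
      exact continuousOn_const.div (by fun_prop) fun α hα => pow_ne_zero 2 (hcos α hα)
  have h2 : ∫ α in crossAngle..(Real.pi / 2), m α
      = Real.pi - 2 * crossAngle - Real.sin (2 * crossAngle) := by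
    have hcongr : ∫ α in crossAngle..(Real.pi / 2), m α
        = ∫ α in crossAngle..(Real.pi / 2), 4 * Real.cos α ^ 2 := by
      refine intervalIntegral.integral_congr fun α hα => ?_
      rw [Set.uIcc_of_le (by linarith)] at hα
      have hle : m α = diskRadialSq α := by
        rcases le_total α (Real.pi / 3) with h | h
        · obtain ⟨h2, h3⟩ := diskRadialSq_le_cross hα.1 h
          exact min_eq_right (h2.trans h3)
        · exact min_eq_of_pi_div_three_le _ h (by linarith [hα.2])
      simp only [hle, diskRadialSq_eq (by linarith [hα.1] : 0 ≤ α) hα.2]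
    rw [hcongr, intervalIntegral.integral_const_mul, integral_cos_sq, Real.cos_pi_div_two,
      Real.sin_two_mul]
    ring
  have h3 : ∫ α in (Real.pi / 2)..Real.pi, m α = 0 := by
    rw [intervalIntegral.integral_congr (g := fun _ => (0 : ℝ)), intervalIntegral.integral_zero]
    intro α hα
    rw [Set.uIcc_of_le (by linarith)] at hα
    have hcos : Real.cos α ≤ 0 :=
      Real.cos_nonpos_of_pi_div_two_le_of_le hα.1 (by linarith [hα.2])
    simp only [hm]
    rw [min_eq_of_pi_div_three_le _ (by linarith [hα.1]) hα.2, diskRadialSq, max_eq_right hcos]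
    norm_num
  have hdouble : 2 * crossAngle = auxAngle + Real.pi / 6 := by unfold crossAngle; ring
  have hs3 : √3 ^ 2 = 3 := Real.sq_sqrt (by norm_num)
  have hinv : 1 / √3 = √3 / 3 := by
    rw [div_eq_div_iff (by positivity) (by norm_num)]
    linear_combination -hs3
  rw [hdouble, Real.sin_add, cos_auxAngle, sin_auxAngle, Real.cos_pi_div_six,
    Real.sin_pi_div_six] at h2
  rw [hinv] at h1
  have hint : ∫ α in (-Real.pi)..Real.pi, m α = 2 * ((∫ α in (0 : ℝ)..crossAngle, m α)
      + (∫ α in crossAngle..(Real.pi / 2), m α) + ∫ α in (Real.pi / 2)..Real.pi, m α) := by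
    rw [intervalIntegral.integral_add_adjacent_intervals (hmi _ _) (hmi _ _),
      intervalIntegral.integral_add_adjacent_intervals (hmi _ _) (hmi _ _),
      ← intervalIntegral.integral_add_adjacent_intervals (hmi _ 0) (hmi 0 _), hneg]
    ring
  simp only [boundaryArea, add_zero]
  rw [hint, h1, h2, h3, minDiskHexArea_eq]
  linear_combination -√11 / 12 * hs3

theorem abs_minDiskHexArea_sub_lt : |minDiskHexArea - 1.6645| < 0.00005 := by
  have hpi := Real.pi_gt_d6
  have hpi' := Real.pi_lt_d6
  have hs3 : √3 ^ 2 = 3 := Real.sq_sqrt (by norm_num)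
  have a1 : (1.732050 : ℝ) < √3 := Real.lt_sqrt_of_sq_lt (by norm_num)
  have a2 : √3 < 1.732051 := (Real.sqrt_lt' (by norm_num)).2 (by norm_num)
  have b1 : (3.316624 : ℝ) < √11 := Real.lt_sqrt_of_sq_lt (by norm_num)
  have b2 : √11 < 3.316625 := (Real.sqrt_lt' (by norm_num)).2 (by norm_num)
  have c1 : (5.7445626 : ℝ) < √33 := Real.lt_sqrt_of_sq_lt (by norm_num)
  have c2 : √33 < 5.7445627 := (Real.sqrt_lt' (by norm_num)).2 (by norm_num)
  have hl := lt_auxAngle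
  have hu := auxAngle_lt
  -- `z` is about `0.06209`, so small that `x - x ^ 3 / 6 < sin x < x` is sharp enough
  set z : ℝ := 5 * Real.pi / 6 - 2 * auxAngle with hz
  have h56 : 5 * Real.pi / 6 = Real.pi - Real.pi / 6 := by ring
  have hsin : Real.sin z = (√33 - 5) / 12 := by
    rw [hz, h56, Real.sin_sub, Real.sin_pi_sub, Real.cos_pi_sub, Real.sin_two_mul,
      Real.cos_two_mul, cos_auxAngle, sin_auxAngle, Real.cos_pi_div_six, Real.sin_pi_div_six,
      sqrt_thirtyThree]
    linear_combination (1 / 36 + √11 * √3 / 36) * hs3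
  have hA : minDiskHexArea = √3 / 36 + √11 / 12 + 5 * Real.pi / 12 + z / 2 := by
    rw [minDiskHexArea_eq, hz]; ring
  have hz_lt : z < 0.062107 := by
    by_contra! h
    have h1 := Real.sin_le_sin_of_le_of_le_pi_div_two (x := 0.062107) (y := z)
      (by linarith) (by linarith) h
    have h2 := Real.sin_gt_sub_cube (x := 0.062107) (by norm_num)
    rw [hsin] at h1
    norm_num at h1 h2
    linarith
  have hz_gt : 0.062 < z := by
    by_contra! h
    have h1 := Real.sin_le_sin_of_le_of_le_pi_div_two (x := z) (y := 0.062)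
      (by linarith) (by linarith) h
    have h2 := Real.sin_lt (x := 0.062) (by norm_num)
    rw [hsin] at h1
    linarith
  rw [hA, abs_lt]
  constructor <;> norm_num <;> linarith

/-! ### The extremal disks -/

theorem boundaryArea_int_mul (k : ℤ) : boundaryArea (k * (Real.pi / 3)) = boundaryArea 0 := by
  have h : ∀ α : ℝ, hexRadialSq (α + k * (Real.pi / 3)) = hexRadialSq α :=
    periodic_hexRadialSq.int_mul k
  simp only [boundaryArea, h, add_zero]

theorem norm_unitVec (α : ℝ) : ‖unitVec α‖ = 1 := by
  rw [EuclideanSpace.norm_eq]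
  simp [unitVec, Fin.sum_univ_two]

/-- The centre of a unit disk through `X` that is collinear with `X` and a vertex lies in the
direction of that vertex or of the opposite one. -/
theorem exists_eq_unitVec_of_collinear {X Y : Plane} {φ : ℝ} {k : Fin 6}
    (hY : dist Y X = 1) (h : Collinear ℝ {Y, X, hexVertex X (4 / 3) φ k}) :
    ∃ m : ℤ, Y = X + unitVec (φ + m * (Real.pi / 3)) := by
  obtain ⟨v, hv⟩ := (collinear_iff_of_mem (p₀ := X) (by simp)).1 h
  obtain ⟨a, ha⟩ := hv Y (by simp)
  obtain ⟨b, hb⟩ := hv (hexVertex X (4 / 3) φ k) (by simp)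
  rw [vadd_eq_add] at ha hb
  rw [hexVertex_eq, add_comm, add_left_inj] at hb
  have hna : |a| * ‖v‖ = 1 := by
    rw [← Real.norm_eq_abs, ← norm_smul, ← hY, ha, dist_eq_norm, add_sub_cancel_right]
  have hnb : |b| * ‖v‖ = 4 / 3 := by
    rw [← Real.norm_eq_abs, ← norm_smul, ← hb, norm_smul, norm_unitVec]
    norm_num
  have hv0 : ‖v‖ ≠ 0 := by
    intro h0
    rw [h0, mul_zero] at hna
    exact zero_ne_one hna
  have hab : |b| = |4 / 3 * a| := by
    rw [abs_mul, abs_of_pos (by norm_num : (0 : ℝ) < 4 / 3)]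
    refine mul_right_cancel₀ hv0 ?_
    rw [hnb, mul_assoc, hna, mul_one]
  rcases abs_eq_abs.1 hab with h1 | h1
  · refine ⟨((k : ℕ) : ℤ), ?_⟩
    rw [h1, mul_smul] at hb
    rw [smul_right_injective Plane (by norm_num : (4 / 3 : ℝ) ≠ 0) hb, ha, add_comm]
  · refine ⟨((k : ℕ) : ℤ) + 3, ?_⟩
    have hang : φ + ((((k : ℕ) : ℤ) + 3 : ℤ) : ℝ) * (Real.pi / 3)
        = φ + (((k : ℕ) : ℤ) : ℝ) * (Real.pi / 3) + Real.pi := by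
      push_cast; ring
    rw [h1, ← mul_neg, mul_smul] at hb
    rw [hang, unitVec_add_pi, smul_right_injective Plane (by norm_num : (4 / 3 : ℝ) ≠ 0) hb,
      ha, neg_smul, neg_neg, add_comm]

theorem mainTheorem3 (X : Plane) (φ : ℝ) :
    IsLeast ((fun Y : Plane => area (regularHexagon X (4 / 3) φ ∩ unitDisk Y)) ''
        {Y : Plane | X ∈ unitDisk Y}) minDiskHexArea ∧
    (∀ Y : Plane, X ∈ frontier (unitDisk Y) →
      (∃ k : Fin 6, Collinear ℝ {Y, X, hexVertex X (4 / 3) φ k}) →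
      area (regularHexagon X (4 / 3) φ ∩ unitDisk Y) = minDiskHexArea) ∧
    |minDiskHexArea - 1.6645| < 0.00005 := by
  refine ⟨⟨⟨X + unitVec φ, ?_, ?_⟩, ?_⟩, ?_, abs_minDiskHexArea_sub_lt⟩
  · simp [unitDisk, dist_eq_norm, norm_unitVec]
  · simp only [area_inter_eq_boundaryArea, sub_self, boundaryArea_zero]
  · rintro _ ⟨Y, hY, rfl⟩
    obtain ⟨ψ, hψ⟩ := exists_eq_add_smul_unitVec X Y
    have hd : dist Y X ≤ 1 := by
      rw [dist_comm]
      exact hY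
    have h := area_inter_unitDisk_add_le X φ (unitVec ψ) dist_nonneg hd
    rw [← hψ, area_inter_eq_boundaryArea] at h
    exact (boundaryArea_zero.symm.trans_le (boundaryArea_zero_le _)).trans h
  · rintro Y hX ⟨k, hk⟩
    rw [unitDisk, frontier_closedBall Y one_ne_zero, Metric.mem_sphere, dist_comm] at hX
    obtain ⟨m, rfl⟩ := exists_eq_unitVec_of_collinear hX hk
    rw [area_inter_eq_boundaryArea, add_sub_cancel_left, boundaryArea_int_mul, boundaryArea_zero]
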